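/- Let $0\le a<b$ be fixed. For integers $N$ and $K\ge 1$ consider $N$ products $0,\dots,N-1$ and the set $S_N$ of permutations (rank lists) of the products, where $\sigma(i)$ is the rank of product $i$ and a smaller rank means more preferred. Draw a random choice model $\lambda:S_N\to[0,1]$ as follows (the generative model): choose $\sigma_1,\dots,\sigma_K\in S_N$ independently and uniformly at random (with replacement) and, independently of them, $K$ independent numbers uniformly distributed on $[a,b]$; normalise these numbers so that they sum to $1$, assign them to $\sigma_1,\dots,\sigma_K$ (weights of repeated permutations add up), and put $\lambda(\sigma)=0$ for every other $\sigma$. The data types are given by $0/1$ matrices $A$ with columns indexed by $S_N$. Comparison data: the rows are the ordered pairs $(i,j)$ of distinct products, and $A(\sigma)_{ij}=1$ iff $\sigma(i)<\sigma(j)$. Ranking data: the rows are the pairs $(r,i)$ of a rank and a product, and $A(\sigma)_{ri}=1$ iff $\sigma(i)=r$. Top-set data: comparison data together with one further row for each product $i$, in which $A(\sigma)_i=1$ iff $i$ has the top rank in $\sigma$. The model $\lambda$ satisfies the signature condition for $A$ if for every $\sigma$ in its support there is a row $d$ with $A(\sigma)_d=1$ and $A(\tau)_d=0$ for every other $\tau$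 in the support. It satisfies the linear independence condition with bound $C$ if $\sum_{\sigma\in\operatorname{supp}\lambda}c_\sigma\lambda(\sigma)\ne0$ for all integers $c_\sigma$, not all zero, with $|c_\sigma|\le C$. Then, for every sequence $K=K(N)\ge1$, with probability $1-o(1)$ as $N\to\infty$, the model $\lambda$ has support size exactly $K$ and satisfies both the signature condition for $A$ and the linear independence condition with every bound $C\ge K$, provided $K=o(\log N)$ if $A$ is the matrix of comparison data, $K=o(\sqrt N)$ if $A$ is the matrix of top-set data, and $K=O(N)$ if $A$ is the matrix of ranking data. -/

import Mathlib

open Filter Topology Asymptotics MeasureTheory ProbabilityTheory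

noncomputable section

namespace ChoiceModel

/-- A rank list over the `N` products `0, …, N - 1`: the permutation `σ` sends a product to its
rank. Ranks are counted from `0`, so that rank `0` is the most preferred position. -/
abbrev RankList (N : ℕ) : Type := Equiv.Perm (Fin N)

/-- The discrete `σ`-algebra on the finite set of rank lists. -/
instance instMeasurableSpaceRankList (N : ℕ) : MeasurableSpace (RankList N) := ⊤

instance instDiscreteMeasurableSpaceRankList (N : ℕ) : DiscreteMeasurableSpace (RankList N) :=
  ⟨fun _ => trivial⟩

/-! ### The three types of data, as matrices with columns indexed by rank lists -/

/-- Comparison data: rows are the ordered pairs `(i, j)` of distinct products, and the entry is `1`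
iff `i` is preferred to `j`. -/
def comparisonMatrix (N : ℕ) :
    Matrix {p : Fin N × Fin N // p.1 ≠ p.2} (RankList N) ℝ :=
  fun p σ => if σ p.1.1 < σ p.1.2 then 1 else 0

/-- Ranking data: rows are the pairs `(r, i)` of a rank and a product, and the entry is `1`
iff `i` has rank `r`. -/
def rankingMatrix (N : ℕ) : Matrix (Fin N × Fin N) (RankList N) ℝ :=
  fun p σ => if σ p.2 = p.1 then 1 else 0

/-- Top-choice data: rows are the products, and the entry is `1` iff the product is the most
preferred one. -/
def topChoiceMatrix (N : ℕ) : Matrix (Fin N) (RankList N) ℝ :=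
  fun i σ => if (σ i : ℕ) = 0 then 1 else 0

/-- Top-set data: the concatenation of comparison data and top-choice data. -/
def topSetMatrix (N : ℕ) :
    Matrix ({p : Fin N × Fin N // p.1 ≠ p.2} ⊕ Fin N) (RankList N) ℝ :=
  Matrix.fromRows (comparisonMatrix N) (topChoiceMatrix N)

/-! ### The two conditions on a choice model `lam` -/

/-- The sparsity `‖lam‖₀`: the number of rank lists in the support. -/
def sparsity {N : ℕ} (lam : RankList N → ℝ) : ℕ := {σ | lam σ ≠ 0}.ncard

/-- Signature condition: every `σ` in the support has a row `d` in which, among the rank lists of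
the support, exactly `σ` has the entry `1`, and all others have the entry `0`. -/
def SignatureCondition {N : ℕ} {D : Type*} (A : Matrix D (RankList N) ℝ)
    (lam : RankList N → ℝ) : Prop :=
  ∀ σ, lam σ ≠ 0 → ∃ d, A d σ = 1 ∧ ∀ τ, lam τ ≠ 0 → τ ≠ σ → A d τ = 0

/-- Linear independence condition with bound `C`: no integer combination of the values of `lam` on
its support, with coefficients at most `C` in absolute value and not all zero, vanishes. -/
def LinearIndependenceCondition {N : ℕ} (C : ℝ) (lam : RankList N → ℝ) : Prop :=
  ∀ c : RankList N → ℤ, (∀ σ, lam σ ≠ 0 → |(c σ : ℝ)| ≤ C) → (∃ σ, lam σ ≠ 0 ∧ c σ ≠ 0) →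
    ∑ σ, (c σ : ℝ) * lam σ ≠ 0

/-! ### The generative model -/

/-- The choice model that assigns to the rank lists `s 0, …, s (K - 1)` the weights
`w 0, …, w (K - 1)` after normalisation to total weight `1`, and `0` to all other rank lists
(weights of repeated rank lists add up). -/
def generated {N K : ℕ} (s : Fin K → RankList N) (w : Fin K → ℝ) : RankList N → ℝ :=
  fun τ => ∑ i, if s i = τ then w i / ∑ j, w j else 0

/-- The joint law of the draws: `K` independent uniformly random rank lists and, independently,
`K` independent numbers uniformly distributed on `[a, b]`. -/
def drawLaw (N K : ℕ) (a b : ℝ) : Measure ((Fin K → RankList N) × (Fin K → ℝ)) :=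
  (Measure.pi fun _ => (PMF.uniformOfFintype (RankList N)).toMeasure).prod
    (Measure.pi fun _ => ProbabilityTheory.cond volume (Set.Icc a b))

/-- The event that the generated choice model has support size `K` and satisfies the signature
condition for `A` and the linear independence condition, the latter with every bound `C ≥ K`. -/
def goodEvent {N : ℕ} (K : ℕ) {D : Type*} (A : Matrix D (RankList N) ℝ) :
    Set ((Fin K → RankList N) × (Fin K → ℝ)) :=
  {x | sparsity (generated x.1 x.2) = K ∧ SignatureCondition A (generated x.1 x.2) ∧
    ∀ C : ℝ, (K : ℝ) ≤ C → LinearIndependenceCondition C (generated x.1 x.2)}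

end ChoiceModel

end

/-! The weights and the rank lists decouple. Each nonzero integer relation confines the weights to a
hyperplane, and there are countably many such relations, so almost surely none holds. This handles
every bound `C` at once, and `mem_goodEvent` reduces the good event to each draw having a row that
separates it from all other draws. A union bound over the `K` draws then requires `K * ε → 0`, where
`ε` bounds the failure probability of a single draw.

For comparison data, each of `N / 2` disjoint pairs of products separates a draw with conditional
probability at least `2 ^ (-K)`, given that other pairs fail. For ranking data, a product separates
with conditional probability at least `((n - 1) / n) ^ K`, where `n > N / 2` products are still
unexamined; this stays above a constant when `K = O(N)`. In both cases the failures multiply over `N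
/ 2` trials (`card_forall_not_mem_le`). For top-set data the top-choice rows suffice: two draws
share their top product with probability at most `1 / N`, so the total error is at most `K ^ 2 / N`.

Conditional probabilities are obtained by counting: composing the draws with permutations of the
products preserves the conditioning event, and enough of these moves reach the desired event
(`mul_card_le_card_mul_card_inter`). -/

namespace ChoiceModel

/-! ### Random weights are almost surely linearly independent over the integers -/

/-- The law of independent uniform draws from `[a, b]` is absolutely continuous. -/
theorem pi_cond_Icc_absolutelyContinuous (K : ℕ) {a b : ℝ} (hab : a < b) :
    (Measure.pi fun _ : Fin K => ProbabilityTheory.cond (volume : Measure ℝ) (Set.Icc a b)) ≪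
      (volume : Measure (Fin K → ℝ)) := by
  have hvol : (volume : Measure ℝ) (Set.Icc a b) ≠ 0 := by simpa using hab
  have : IsProbabilityMeasure (ProbabilityTheory.cond (volume : Measure ℝ) (Set.Icc a b)) :=
    cond_isProbabilityMeasure_of_finite hvol (by simp)
  have h : (Measure.pi fun _ : Fin K => ProbabilityTheory.cond (volume : Measure ℝ) (Set.Icc a b)) =
      ((volume (Set.Icc a b))⁻¹ ^ K) •
        (volume : Measure (Fin K → ℝ)).restrict (Set.univ.pi fun _ => Set.Icc a b) := by
    refine Measure.pi_eq fun s hs => ?_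
    rw [Measure.smul_apply, Measure.restrict_apply (MeasurableSet.univ_pi hs),
      ← Set.pi_inter_distrib, volume_pi_pi]
    simp only [cond_apply measurableSet_Icc, smul_eq_mul, Finset.prod_mul_distrib,
      Finset.prod_const, Finset.card_univ, Fintype.card_fin, Set.inter_comm]
  rw [h]
  exact (Measure.restrict_le_self.absolutelyContinuous).smul_left _

/-- A hyperplane through the origin is Lebesgue-null. -/
theorem volume_sum_mul_eq_zero {K : ℕ} {c : Fin K → ℤ} (hc : c ≠ 0) :
    (volume : Measure (Fin K → ℝ)) {w | ∑ i, (c i : ℝ) * w i = 0} = 0 := by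
  classical
  obtain ⟨i, hi⟩ := Function.ne_iff.mp hc
  let f : (Fin K → ℝ) →ₗ[ℝ] ℝ := Fintype.linearCombination ℝ (fun i => (c i : ℝ))
  have hset : {w : Fin K → ℝ | ∑ i, (c i : ℝ) * w i = 0} = (LinearMap.ker f : Set _) := by
    ext w
    simp [f, Fintype.linearCombination_apply, mul_comm]
  rw [hset]
  -- The kernel is a proper subspace: the unit vector at a coordinate with `c i ≠ 0` lies outside
  -- it.
  refine Measure.addHaar_submodule _ _ fun htop => hi ?_
  have hmem : (Pi.single i 1 : Fin K → ℝ) ∈ LinearMap.ker f := htop ▸ Submodule.mem_top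
  simpa [f] using hmem

theorem ae_integer_linearIndependent (K : ℕ) {a b : ℝ} (hab : a < b) :
    ∀ᵐ w ∂(Measure.pi fun _ : Fin K =>
      ProbabilityTheory.cond (volume : Measure ℝ) (Set.Icc a b)),
      ∀ c : Fin K → ℤ, c ≠ 0 → ∑ i, (c i : ℝ) * w i ≠ 0 := by
  rw [ae_all_iff]
  intro c
  by_cases hc : c = 0
  · simp [hc]
  · have h := pi_cond_Icc_absolutelyContinuous K hab (volume_sum_mul_eq_zero hc)
    filter_upwards [compl_mem_ae_iff.mpr h] with w hw _
    exact hw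

/-! ### Reduction of the good event to the existence of signature rows -/

/-- The draw `s k` has a row that separates it from all the other draws. -/
def HasSignatureRow {N K : ℕ} {D : Type*} (A : Matrix D (RankList N) ℝ)
    (s : Fin K → RankList N) (k : Fin K) : Prop :=
  ∃ d, A d (s k) = 1 ∧ ∀ l, l ≠ k → A d (s l) = 0

/-- Signature rows separate draws by index, so they also force the draws to be distinct. The
normalised weights then sit on exactly `K` rank lists, and dividing by their nonzero total does not
affect integer relations. -/
theorem mem_goodEvent {N K : ℕ} (hK : 1 ≤ K) {D : Type*} {A : Matrix D (RankList N) ℝ}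
    {s : Fin K → RankList N} {w : Fin K → ℝ} (hs : ∀ k, HasSignatureRow A s k)
    (hw : ∀ c : Fin K → ℤ, c ≠ 0 → ∑ i, (c i : ℝ) * w i ≠ 0) :
    (s, w) ∈ goodEvent K A := by
  classical
  have hinj : Function.Injective s := by
    intro k l hkl
    by_contra hne
    obtain ⟨d, h1, h0⟩ := hs k
    have := h0 l (Ne.symm hne)
    rw [← hkl, h1] at this
    exact one_ne_zero this
  have hw0 : ∀ i, w i ≠ 0 := by
    intro i
    have := hw (Pi.single i 1) (by simp)
    simpa [Pi.single_apply] using this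
  -- The all-ones relation, nonzero because `K ≥ 1`, rules out a vanishing total; unit vectors did
  -- the same for single weights.
  have hsum : ∑ j, w j ≠ 0 := by
    have := hw 1 (by
      intro h
      have := congrFun h ⟨0, hK⟩
      simp at this)
    simpa using this
  have hgen : ∀ i, generated s w (s i) = w i / ∑ j, w j := by
    intro i
    simp [generated, hinj.eq_iff]
  have hgen0 : ∀ τ, generated s w τ ≠ 0 ↔ τ ∈ Set.range s := by
    intro τ
    constructor
    · intro h
      obtain ⟨i, -, hi⟩ := Finset.exists_ne_zero_of_sum_ne_zero h
      exact ⟨i, by_contra fun hne => hi (if_neg hne)⟩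
    · rintro ⟨i, rfl⟩
      rw [hgen]
      exact div_ne_zero (hw0 i) hsum
  refine ⟨?_, ?_, ?_⟩
  · have : {τ | generated s w τ ≠ 0} = Set.range s := Set.ext hgen0
    simp only [sparsity, this]
    rw [← Set.image_univ, Set.ncard_image_of_injective _ hinj]
    simp
  · intro σ hσ
    obtain ⟨k, rfl⟩ := (hgen0 σ).mp hσ
    obtain ⟨d, h1, h0⟩ := hs k
    refine ⟨d, h1, fun τ hτ hne => ?_⟩
    obtain ⟨l, rfl⟩ := (hgen0 τ).mp hτ
    exact h0 l fun h => hne (by rw [h])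
  · rintro C - c - ⟨σ, hσ, hcσ⟩
    obtain ⟨k, rfl⟩ := (hgen0 σ).mp hσ
    have h := hw (c ∘ s) fun h => hcσ (congrFun h k)
    have heq : ∑ σ, (c σ : ℝ) * generated s w σ = (∑ i, ((c ∘ s) i : ℝ) * w i) / ∑ j, w j := by
      have hsub : ∑ σ ∈ Finset.univ.image s, (c σ : ℝ) * generated s w σ =
          ∑ σ, (c σ : ℝ) * generated s w σ := by
        refine Finset.sum_subset (Finset.subset_univ _) fun τ _ hτ => ?_
        have : generated s w τ = 0 := by
          by_contra hne
          exact hτ (by simpa using (hgen0 τ).mp hne)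
        rw [this, mul_zero]
      rw [← hsub, Finset.sum_image (fun _ _ _ _ h => hinj h), Finset.sum_div]
      refine Finset.sum_congr rfl fun i _ => ?_
      rw [hgen, mul_div_assoc, Function.comp_apply]
    rw [heq]
    exact div_ne_zero h hsum

/-- The law of independent uniform rank lists is the normalised counting measure. -/
theorem pi_uniform_apply {N K : ℕ} (S : Set (Fin K → RankList N)) :
    (Measure.pi fun _ : Fin K => (PMF.uniformOfFintype (RankList N)).toMeasure) S =
      ENNReal.ofReal (S.ncard / Fintype.card (Fin K → RankList N)) := by
  classical
  have hS : S = ⋃ x ∈ S.toFinset, {x} := by ext; simp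
  have h1 : (Measure.pi fun _ : Fin K => (PMF.uniformOfFintype (RankList N)).toMeasure) S =
      ∑ x ∈ S.toFinset, (Measure.pi fun _ : Fin K =>
        (PMF.uniformOfFintype (RankList N)).toMeasure) {x} := by
    rw [sum_measure_singleton, Set.coe_toFinset]
  rw [h1]
  simp only [Measure.pi_singleton, PMF.toMeasure_apply_singleton _ _ (measurableSet_singleton _),
    PMF.uniformOfFintype_apply, Finset.prod_const, Finset.sum_const, Finset.card_univ,
    Fintype.card_fin, nsmul_eq_mul]
  rw [ENNReal.ofReal_div_of_pos (by positivity), Set.ncard_eq_toFinset_card', div_eq_mul_inv,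
    Fintype.card_fun, Fintype.card_fin]
  simp [ENNReal.inv_pow]

/-- If each draw fails to have a signature row with small probability, then the good event has
large probability. -/
theorem le_drawLaw_goodEvent {N K : ℕ} (hK : 1 ≤ K) {a b : ℝ} (hab : a < b) {D : Type*}
    (A : Matrix D (RankList N) ℝ) {ε : ℝ}
    (hε : ∀ k : Fin K, ({s | ¬ HasSignatureRow A s k}.ncard : ℝ) ≤
      ε * Fintype.card (Fin K → RankList N)) :
    1 - ENNReal.ofReal (K * ε) ≤ drawLaw N K a b (goodEvent K A) := by
  set μ := Measure.pi fun _ : Fin K => (PMF.uniformOfFintype (RankList N)).toMeasure with hμ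
  set ν := Measure.pi fun _ : Fin K =>
    ProbabilityTheory.cond (volume : Measure ℝ) (Set.Icc a b) with hν
  have hprob : IsProbabilityMeasure
      (ProbabilityTheory.cond (volume : Measure ℝ) (Set.Icc a b)) :=
    cond_isProbabilityMeasure_of_finite (by simpa using hab) (by simp)
  let S : Set (Fin K → RankList N) := {s | ∀ k, HasSignatureRow A s k}
  let W : Set (Fin K → ℝ) := {w | ∀ c : Fin K → ℤ, c ≠ 0 → ∑ i, (c i : ℝ) * w i ≠ 0}
  have hsub : S ×ˢ W ⊆ goodEvent K A := fun x hx => mem_goodEvent hK hx.1 hx.2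
  have hW : ν W = 1 := by
    rw [← measure_univ (μ := ν)]
    exact measure_congr (eventuallyEq_univ.mpr (ae_integer_linearIndependent K hab))
  have hbad : μ Sᶜ ≤ ENNReal.ofReal (K * ε) := by
    have hS : Sᶜ = ⋃ k, {s | ¬ HasSignatureRow A s k} := by
      ext s
      simp [S]
    rw [hS]
    calc μ (⋃ k, {s | ¬ HasSignatureRow A s k})
        ≤ ∑ k : Fin K, μ {s | ¬ HasSignatureRow A s k} := measure_iUnion_fintype_le _ _
      _ ≤ ∑ _k : Fin K, ENNReal.ofReal ε := by
          refine Finset.sum_le_sum fun k _ => ?_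
          rw [hμ, pi_uniform_apply]
          refine ENNReal.ofReal_le_ofReal ?_
          rw [div_le_iff₀ (by positivity)]
          exact hε k
      _ = ENNReal.ofReal (K * ε) := by
          rw [ENNReal.ofReal_mul (by positivity)]
          simp
  have hSm : MeasurableSet S := (Set.toFinite S).measurableSet
  calc 1 - ENNReal.ofReal (K * ε) ≤ 1 - μ Sᶜ := tsub_le_tsub_left hbad 1
    _ = μ S := by
        rw [prob_compl_eq_one_sub hSm, ENNReal.sub_sub_cancel ENNReal.one_ne_top prob_le_one]
    _ = drawLaw N K a b (S ×ˢ W) := by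
        rw [drawLaw, ← hμ, ← hν, Measure.prod_prod, hW, mul_one]
    _ ≤ _ := measure_mono hsub

theorem tendsto_drawLaw_goodEvent {a b : ℝ} (hab : a < b) {K : ℕ → ℕ} (hK : ∀ N, 1 ≤ K N)
    {D : ℕ → Type*} (A : ∀ N, Matrix (D N) (RankList N) ℝ) (ε : ℕ → ℝ)
    (hε : ∀ᶠ N in atTop, ∀ k : Fin (K N), ({s | ¬ HasSignatureRow (A N) s k}.ncard : ℝ) ≤
      ε N * Fintype.card (Fin (K N) → RankList N))
    (hlim : Tendsto (fun N => K N * ε N) atTop (𝓝 0)) :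
    Tendsto (fun N => drawLaw N (K N) a b (goodEvent (K N) (A N))) atTop (𝓝 1) := by
  have hprob : IsProbabilityMeasure
      (ProbabilityTheory.cond (volume : Measure ℝ) (Set.Icc a b)) :=
    cond_isProbabilityMeasure_of_finite (by simpa using hab) (by simp)
  have hlow : Tendsto (fun N => 1 - ENNReal.ofReal (K N * ε N)) atTop (𝓝 1) := by
    have h := ENNReal.Tendsto.sub (tendsto_const_nhds (x := (1 : ENNReal)) (f := atTop))
      (ENNReal.tendsto_ofReal hlim) (Or.inl ENNReal.one_ne_top)
    simpa using h
  refine tendsto_of_tendsto_of_tendsto_of_le_of_le' hlow tendsto_const_nhds ?_ ?_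
  · filter_upwards [hε] with N hN
    exact le_drawLaw_goodEvent (hK N) hab (A N) hN
  · refine Eventually.of_forall fun N => ?_
    have : IsProbabilityMeasure (drawLaw N (K N) a b) := by
      unfold drawLaw
      infer_instance
    exact prob_le_one

/-! ### Counting by resampling -/

/-- If, from every point of `B`, at least `n` of the injective moves `act h` lead into `G`, and all
moves preserve `B`, then `G` occupies a proportion at least `n / |H|` of `B`. -/
theorem mul_card_le_card_mul_card_inter {Ω H : Type*} [DecidableEq Ω] [Fintype H]
    (B G : Finset Ω) (act : H → Ω → Ω) (hinj : ∀ h, Function.Injective (act h))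
    (hB : ∀ h, ∀ x ∈ B, act h x ∈ B) (n : ℕ)
    (hn : ∀ x ∈ B, n ≤ (Finset.univ.filter fun h => act h x ∈ G).card) :
    n * B.card ≤ Fintype.card H * (B ∩ G).card := by
  -- Double counting of the pairs `(x, h)` with `x ∈ B` and `act h x ∈ G`; for fixed `h` the move
  -- injects these `x` into `B ∩ G`.
  calc n * B.card = ∑ _x ∈ B, n := by rw [Finset.sum_const, smul_eq_mul, mul_comm]
    _ ≤ ∑ x ∈ B, (Finset.univ.filter fun h => act h x ∈ G).card := Finset.sum_le_sum hn
    _ = ∑ h : H, (B.filter fun x => act h x ∈ G).card := by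
        simp only [Finset.card_filter]
        exact Finset.sum_comm
    _ ≤ ∑ _h : H, (B ∩ G).card := by
        refine Finset.sum_le_sum fun h _ =>
          Finset.card_le_card_of_injOn (act h) ?_ (hinj h).injOn
        intro x hx
        have hx' := Finset.mem_filter.mp hx
        exact Finset.mem_inter.mpr ⟨hB h x hx'.1, hx'.2⟩
    _ = Fintype.card H * (B ∩ G).card := by simp

/-- If each of the events `G i` has conditional probability at least `δ` given that the previous
ones fail, then all those in `T` fail with probability at most `(1 - δ) ^ |T|`. -/
theorem card_forall_not_mem_le {Ω ι : Type*} [Fintype Ω] [DecidableEq Ω] [DecidableEq ι]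
    (G : ι → Finset Ω) (M : ℕ) {δ : ℝ} (hδ1 : δ ≤ 1)
    (hstep : ∀ (T : Finset ι) (B : Finset Ω) (i : ι), (∀ x, x ∈ B ↔ ∀ j ∈ T, x ∉ G j) →
      i ∉ T → T.card < M → δ * (B.card : ℝ) ≤ ((B ∩ G i).card : ℝ)) (T : Finset ι) :
    T.card ≤ M → ∀ B : Finset Ω, (∀ x, x ∈ B ↔ ∀ j ∈ T, x ∉ G j) →
      (B.card : ℝ) ≤ (1 - δ) ^ T.card * Fintype.card Ω := by
  induction T using Finset.induction_on with
  | empty =>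
    intro _ B _
    simpa using B.card_le_univ
  | insert i T hi ih =>
    intro hcard B' hB'
    rw [Finset.card_insert_of_notMem hi] at hcard ⊢
    set B := Finset.univ.filter fun x => ∀ j ∈ T, x ∉ G j with hB
    have hBmem : ∀ x, x ∈ B ↔ ∀ j ∈ T, x ∉ G j := by simp [hB]
    have h1 := hstep T B i hBmem hi hcard
    have h2 := ih (by omega) B hBmem
    have heq : B' = B \ G i := by
      ext x
      simp [hB', hB, and_comm]
    have h3 : ((B \ G i).card : ℝ) + ((B ∩ G i).card : ℝ) = B.card := by
      exact_mod_cast Finset.card_sdiff_add_card_inter B (G i)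
    rw [heq]
    calc ((B \ G i).card : ℝ) ≤ (1 - δ) * B.card := by linarith
      _ ≤ (1 - δ) * ((1 - δ) ^ T.card * Fintype.card Ω) :=
          mul_le_mul_of_nonneg_left h2 (by linarith)
      _ = _ := by ring

/-! ### Comparison data -/

open Classical in
/-- The draws for which comparing `p` with `q` separates the draw `k` from the others. -/
def comparisonGood {N K : ℕ} (k : Fin K) (p q : Fin N) : Finset (Fin K → RankList N) :=
  Finset.univ.filter fun s => s k p < s k q ∧ ∀ l, l ≠ k → s l q < s l p

theorem hasSignatureRow_of_mem_comparisonGood {N K : ℕ} {k : Fin K} {p q : Fin N} (hpq : p ≠ q)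
    {s : Fin K → RankList N} (hs : s ∈ comparisonGood k p q) :
    HasSignatureRow (comparisonMatrix N) s k := by
  simp only [comparisonGood, Finset.mem_filter, Finset.mem_univ, true_and] at hs
  exact ⟨⟨(p, q), hpq⟩, if_pos hs.1, fun l hl => if_neg (hs.2 l hl).not_gt⟩

/-- The pairs `(2i, 2i + 1)` are disjoint, so swapping one pair in any subset of the draws leaves
the outcomes of the other pairs unchanged. -/
theorem comparison_ncard_not_hasSignatureRow_le {N K : ℕ} (k : Fin K) :
    ({s | ¬ HasSignatureRow (comparisonMatrix N) s k}.ncard : ℝ) ≤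
      (1 - 1 / 2 ^ K) ^ (N / 2) * Fintype.card (Fin K → RankList N) := by
  classical
  let p : Fin (N / 2) → Fin N := fun i => ⟨2 * i, by omega⟩
  let q : Fin (N / 2) → Fin N := fun i => ⟨2 * i + 1, by omega⟩
  have hpq : ∀ i j, p i ≠ q j := by
    intro i j h
    have := congrArg Fin.val h
    simp only [p, q] at this
    omega
  have hp : ∀ i j, p i = p j → i = j := by
    intro i j h
    have := congrArg Fin.val h
    simp only [p] at this
    exact Fin.ext (by omega)
  have hq : ∀ i j, q i = q j → i = j := by
    intro i j h
    have := congrArg Fin.val h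
    simp only [q] at this
    exact Fin.ext (by omega)
  have key := card_forall_not_mem_le (fun i => comparisonGood k (p i) (q i)) (N / 2)
    (δ := 1 / 2 ^ K) (by
      rw [div_le_one (by positivity)]
      exact one_le_pow₀ (by norm_num)) (by
    intro T B i hB hi _
    have h := mul_card_le_card_mul_card_inter B (comparisonGood k (p i) (q i))
      (fun (h : Fin K → Bool) s => s * fun l => if h l then Equiv.swap (p i) (q i) else 1)
      (fun h => mul_left_injective _) (by
        intro h s hs
        rw [hB] at hs ⊢
        intro j hj
        have hij : j ≠ i := fun hji => hi (hji ▸ hj)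
        have hpj : ∀ l, (s * fun l => if h l then Equiv.swap (p i) (q i) else 1) l (p j) =
            s l (p j) := by
          intro l
          by_cases hl : h l <;> simp [hl, Equiv.swap_apply_of_ne_of_ne (fun e => hij (hp _ _ e))
            (hpq j i)]
        have hqj : ∀ l, (s * fun l => if h l then Equiv.swap (p i) (q i) else 1) l (q j) =
            s l (q j) := by
          intro l
          by_cases hl : h l <;> simp [hl, Equiv.swap_apply_of_ne_of_ne (hpq i j).symm
            (fun e => hij (hq _ _ e))]
        have := hs j hj
        simp only [comparisonGood, Finset.mem_filter, Finset.mem_univ, true_and] at this ⊢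
        simpa only [hpj, hqj] using this) 1 (by
        intro s _
        -- One of the `2 ^ K` swap patterns works: swap exactly in those draws whose order of the
        -- pair is wrong.
        refine Finset.card_pos.mpr ⟨fun l => if l = k then decide (s l (q i) < s l (p i)) else
          decide (s l (p i) < s l (q i)), ?_⟩
        have hne : ∀ l, s l (p i) ≠ s l (q i) := fun l e => hpq i i ((s l).injective e)
        simp only [comparisonGood, Finset.mem_filter, Finset.mem_univ, true_and, Pi.mul_apply,
          Equiv.Perm.mul_apply]
        constructor
        · by_cases hk : s k (q i) < s k (p i)
          · simp [hk]
          · simpa [hk] using lt_of_le_of_ne (not_lt.mp hk) (hne k)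
        · intro l hl
          by_cases hk : s l (p i) < s l (q i)
          · simp [hl, hk]
          · simpa [hl, hk] using lt_of_le_of_ne (not_lt.mp hk) (hne l).symm)
    have h' : (B.card : ℝ) ≤ 2 ^ K * ((B ∩ comparisonGood k (p i) (q i)).card : ℝ) := by
      have : B.card ≤ 2 ^ K * (B ∩ comparisonGood k (p i) (q i)).card := by simpa using h
      exact_mod_cast this
    rw [one_div, inv_mul_le_iff₀ (by positivity)]
    exact h') Finset.univ (by simp)
    (Finset.univ.filter fun s => ∀ j, s ∉ comparisonGood k (p j) (q j)) (by simp)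
  rw [Finset.card_univ, Fintype.card_fin] at key
  refine le_trans ?_ key
  rw [← Set.ncard_coe_finset]
  refine Nat.cast_le.mpr (Set.ncard_le_ncard ?_ (Set.toFinite _))
  intro s hs
  simp only [Finset.coe_filter, Finset.mem_univ, true_and, Set.mem_ofPred_eq]
  exact fun i hi => hs (hasSignatureRow_of_mem_comparisonGood (hpq i i) hi)

/-! ### Ranking data -/

open Classical in
/-- The draws for which the rank of `i` separates the draw `k` from the others. -/
def rankingGood {N K : ℕ} (k : Fin K) (i : Fin N) : Finset (Fin K → RankList N) :=
  Finset.univ.filter fun s => ∀ l, l ≠ k → s l i ≠ s k i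

theorem hasSignatureRow_of_mem_rankingGood {N K : ℕ} {k : Fin K} {i : Fin N}
    {s : Fin K → RankList N} (hs : s ∈ rankingGood k i) :
    HasSignatureRow (rankingMatrix N) s k := by
  simp only [rankingGood, Finset.mem_filter, Finset.mem_univ, true_and] at hs
  exact ⟨(s k i, i), if_pos rfl, fun l hl => if_neg (hs l hl)⟩

/-- In every draw except `k`, product `i` trades ranks with an arbitrary product outside `T`,
possibly itself, so events about `T` are untouched. Stopping at `N / 2` products keeps `n = N - |T|`
above `N / 2`. -/
theorem ranking_ncard_not_hasSignatureRow_le {N K : ℕ} (k : Fin K) {δ : ℝ} (hδ1 : δ ≤ 1)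
    (hδ : ∀ n : ℕ, N < 2 * n → δ * n ^ K ≤ ((n - 1 : ℕ) : ℝ) ^ K) :
    ({s | ¬ HasSignatureRow (rankingMatrix N) s k}.ncard : ℝ) ≤
      (1 - δ) ^ (N / 2) * Fintype.card (Fin K → RankList N) := by
  classical
  obtain ⟨T₀, -, hT₀⟩ := Finset.exists_subset_card_eq (s := (Finset.univ : Finset (Fin N)))
    (n := N / 2) (by simp; omega)
  have key := card_forall_not_mem_le (fun i : Fin N => rankingGood k i) (N / 2)
    hδ1 (by
    intro T B i hB hi hT
    have hcardT : Fintype.card {j // j ∉ T} = N - T.card := by simp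
    have h := mul_card_le_card_mul_card_inter B (rankingGood k i)
      (fun (h : Fin K → {j // j ∉ T}) s =>
        s * fun l => if l = k then 1 else Equiv.swap i (h l : Fin N))
      (fun h => mul_left_injective _) (by
        intro h s hs
        rw [hB] at hs ⊢
        intro j hj
        have hij : j ≠ i := fun hji => hi (hji ▸ hj)
        have hpj : ∀ l, (s * fun l => if l = k then 1 else Equiv.swap i (h l : Fin N)) l j =
            s l j := by
          intro l
          by_cases hl : l = k
          · simp [hl]
          · simp [hl, Equiv.swap_apply_of_ne_of_ne hij (fun e : j = h l => (h l).2 (e ▸ hj))]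
        have := hs j hj
        simp only [rankingGood, Finset.mem_filter, Finset.mem_univ, true_and] at this ⊢
        simpa only [hpj] using this) ((N - T.card - 1) ^ K) (by
        intro s _
        -- After the move, `i` has rank `s l (h l)` in draw `l`; at most one choice of `h l`
        -- collides with `s k i`. The coordinate `h k` is idle and merely keeps the exponent at `K`.
        let U : Fin K → Finset {j // j ∉ T} := fun l => Finset.univ.filter fun j => s l j ≠ s k i
        have hU : ∀ l, N - T.card - 1 ≤ (U l).card := by
          intro l
          have h1 := Finset.card_filter_add_card_filter_not
            (s := (Finset.univ : Finset {j // j ∉ T})) (fun j => s l j = s k i)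
          have h2 : (Finset.univ.filter fun j : {j // j ∉ T} => s l j = s k i).card ≤ 1 := by
            refine Finset.card_le_one.mpr fun x hx y hy => ?_
            simp only [Finset.mem_filter, Finset.mem_univ, true_and] at hx hy
            exact Subtype.ext ((s l).injective (hx.trans hy.symm))
          rw [Finset.card_univ, hcardT] at h1
          change N - T.card - 1 ≤ (Finset.univ.filter fun j : {j // j ∉ T} =>
            ¬ s l j = s k i).card
          omega
        calc (N - T.card - 1) ^ K = ∏ _l : Fin K, (N - T.card - 1) := by simp
          _ ≤ ∏ l, (U l).card := Finset.prod_le_prod' fun l _ => hU l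
          _ = (Fintype.piFinset U).card := (Fintype.card_piFinset U).symm
          _ ≤ _ := by
            refine Finset.card_le_card fun h hh => ?_
            simp only [Fintype.mem_piFinset, U, Finset.mem_filter, Finset.mem_univ,
              true_and] at hh
            simp only [rankingGood, Finset.mem_filter, Finset.mem_univ, true_and, Pi.mul_apply,
              Equiv.Perm.mul_apply]
            intro l hl
            simpa [hl] using hh l)
    rw [Fintype.card_fun, hcardT, Fintype.card_fin] at h
    have hn := hδ (N - T.card) (by omega)
    have hpos : (0 : ℝ) < ((N - T.card : ℕ) : ℝ) ^ K := by
      have : 0 < N - T.card := by omega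
      positivity
    have h' : ((N - T.card - 1 : ℕ) : ℝ) ^ K * (B.card : ℝ) ≤
        ((N - T.card : ℕ) : ℝ) ^ K * ((B ∩ rankingGood k i).card : ℝ) := by
      exact_mod_cast h
    refine le_of_mul_le_mul_left ?_ hpos
    calc _ = δ * ((N - T.card : ℕ) : ℝ) ^ K * B.card := by ring
      _ ≤ ((N - T.card - 1 : ℕ) : ℝ) ^ K * B.card :=
        mul_le_mul_of_nonneg_right hn (by positivity)
      _ ≤ _ := h') T₀ hT₀.le
    (Finset.univ.filter fun s => ∀ j ∈ T₀, s ∉ rankingGood k j) (by simp)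
  rw [hT₀] at key
  refine le_trans ?_ key
  rw [← Set.ncard_coe_finset]
  refine Nat.cast_le.mpr (Set.ncard_le_ncard ?_ (Set.toFinite _))
  intro s hs
  simp only [Finset.coe_filter, Finset.mem_univ, true_and, Set.mem_ofPred_eq]
  exact fun i _ hi => hs (hasSignatureRow_of_mem_rankingGood hi)

/-! ### Top-set data -/

open Classical in
/-- Two different draws have the same top product with probability at most `1 / N`. -/
theorem mul_card_same_top_le {N K : ℕ} {k l : Fin K} (hlk : l ≠ k) :
    N * (Finset.univ.filter fun s : Fin K → RankList N =>
      ∃ i, (s k i : ℕ) = 0 ∧ (s l i : ℕ) = 0).card ≤ Fintype.card (Fin K → RankList N) := by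
  obtain _ | n := N
  · simp
  set P : (Fin K → RankList (n + 1)) → Prop := fun s => ∃ i, (s k i : ℕ) = 0 ∧ (s l i : ℕ) = 0
  have hP : ∀ s, P s ↔ (s l).symm 0 = (s k).symm 0 := by
    intro s
    constructor
    · rintro ⟨i, hk, hl⟩
      have hk' : s k i = 0 := Fin.ext hk
      have hl' : s l i = 0 := Fin.ext hl
      rw [← hk', Equiv.symm_apply_apply, hk', ← hl', Equiv.symm_apply_apply]
    · intro h
      exact ⟨(s k).symm 0, by simp, by rw [← h]; simp⟩
  -- Cyclically shifting the products in draw `l` by `j` moves its top product by `-j`, so exactly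
  -- one of the `n + 1` shifts makes it agree with that of draw `k`.
  have h := mul_card_le_card_mul_card_inter Finset.univ
    (Finset.univ.filter fun s : Fin K → RankList (n + 1) => ¬ P s)
    (fun (j : Fin (n + 1)) s => s * fun m => if m = l then Equiv.addRight j else 1)
    (fun j => mul_left_injective _) (fun _ _ _ => Finset.mem_univ _) n (by
      intro s _
      have h1 := Finset.card_filter_add_card_filter_not
        (s := (Finset.univ : Finset (Fin (n + 1))))
        (fun j => j = (s l).symm 0 - (s k).symm 0)
      have h2 : (Finset.univ.filter fun j : Fin (n + 1) =>
          j = (s l).symm 0 - (s k).symm 0).card = 1 := by simp [Finset.filter_eq']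
      rw [Finset.card_univ, Fintype.card_fin] at h1
      refine le_trans (by omega : n ≤ (Finset.univ.filter fun j : Fin (n + 1) =>
        ¬ j = (s l).symm 0 - (s k).symm 0).card) (Finset.card_le_card fun j hj => ?_)
      simp only [Finset.mem_filter, Finset.mem_univ, true_and, hP] at hj ⊢
      intro e
      apply hj
      have e' : (s l).symm 0 - j = (s k).symm 0 := by
        have e1 : ((s * fun m => if m = l then Equiv.addRight j else 1) l).symm 0 =
            (s l).symm 0 - j := by
          rw [Equiv.symm_apply_eq]
          simp
        have e2 : ((s * fun m => if m = l then Equiv.addRight j else 1) k).symm 0 =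
            (s k).symm 0 := by
          simp [Ne.symm hlk]
        rw [e1, e2] at e
        exact e
      rw [← e']
      abel)
  rw [Finset.univ_inter, Finset.card_univ, Fintype.card_fin] at h
  have h3 := Finset.card_filter_add_card_filter_not
    (s := (Finset.univ : Finset (Fin K → RankList (n + 1)))) P
  rw [Finset.card_univ] at h3
  have h4 : (n + 1) * (Finset.univ.filter P).card ≤ Fintype.card (Fin K → RankList (n + 1)) := by
    nlinarith
  convert h4

theorem topSet_ncard_not_hasSignatureRow_le {N K : ℕ} (hN : 0 < N) (k : Fin K) :
    ({s | ¬ HasSignatureRow (topSetMatrix N) s k}.ncard : ℝ) ≤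
      (K / N : ℝ) * Fintype.card (Fin K → RankList N) := by
  classical
  let E : Fin K → Finset (Fin K → RankList N) := fun l =>
    Finset.univ.filter fun s => ∃ i, (s k i : ℕ) = 0 ∧ (s l i : ℕ) = 0
  have hsub : {s | ¬ HasSignatureRow (topSetMatrix N) s k} ⊆
      ((Finset.univ.erase k).biUnion E : Set (Fin K → RankList N)) := by
    intro s hs
    by_contra hcon
    refine hs ⟨Sum.inr ((s k).symm ⟨0, hN⟩), by simp [topSetMatrix, topChoiceMatrix], ?_⟩
    intro l hl
    simp only [topSetMatrix, Matrix.fromRows_apply_inr, topChoiceMatrix, ite_eq_right_iff,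
      one_ne_zero, imp_false]
    intro h0
    apply hcon
    simp only [Finset.mem_coe, Finset.mem_biUnion, Finset.mem_erase, Finset.mem_univ, and_true, E,
      Finset.mem_filter, true_and]
    exact ⟨l, hl, (s k).symm ⟨0, hN⟩, by simp, h0⟩
  have h1 : ({s | ¬ HasSignatureRow (topSetMatrix N) s k}.ncard : ℝ) ≤
      ∑ l ∈ Finset.univ.erase k, ((E l).card : ℝ) := by
    have := (Set.ncard_le_ncard hsub (Set.toFinite _)).trans_eq (Set.ncard_coe_finset _)
    exact_mod_cast this.trans Finset.card_biUnion_le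
  have hN' : (0 : ℝ) < N := by exact_mod_cast hN
  calc _ ≤ ∑ l ∈ Finset.univ.erase k, ((E l).card : ℝ) := h1
    _ ≤ ∑ _l ∈ Finset.univ.erase k, (Fintype.card (Fin K → RankList N) : ℝ) / N := by
      refine Finset.sum_le_sum fun l hl => ?_
      rw [le_div_iff₀ hN', mul_comm]
      exact_mod_cast mul_card_same_top_le (Finset.ne_of_mem_erase hl)
    _ ≤ ∑ _l : Fin K, (Fintype.card (Fin K → RankList N) : ℝ) / N :=
      Finset.sum_le_sum_of_subset_of_nonneg (Finset.erase_subset _ _) fun _ _ _ => by positivity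
    _ = _ := by
      rw [Finset.sum_const, Finset.card_univ, Fintype.card_fin, nsmul_eq_mul]
      ring

/-! ### The error terms vanish -/

/-- Eventually `K ≤ log N / 4`, so `K * 2 ^ K ≤ exp (2 * K) ≤ √N`. With `t = (N / 2) / 2 ^ K`, the
power is at most `exp (-t) ≤ 1 / t`, and the product is `O(1 / √N)`. -/
theorem tendsto_comparison_error {K : ℕ → ℕ}
    (h : (fun N : ℕ => (K N : ℝ)) =o[atTop] (fun N : ℕ => Real.log (N : ℝ))) :
    Tendsto (fun N => (K N : ℝ) * (1 - 1 / 2 ^ K N) ^ (N / 2)) atTop (𝓝 0) := by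
  have hlim : Tendsto (fun N : ℕ => 3 / Real.sqrt N) atTop (𝓝 0) :=
    (Real.tendsto_sqrt_atTop.comp tendsto_natCast_atTop_atTop).const_div_atTop 3
  have hle : ∀ N, (0 : ℝ) ≤ 1 - 1 / 2 ^ K N := by
    intro N
    rw [sub_nonneg, div_le_one (by positivity)]
    exact one_le_pow₀ (by norm_num)
  refine squeeze_zero' (Eventually.of_forall fun N =>
    mul_nonneg (by positivity) (pow_nonneg (hle N) _)) ?_ hlim
  filter_upwards [h.bound (by norm_num : (0 : ℝ) < 1 / 4), eventually_ge_atTop 2] with N hN hN2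
  have hN0 : (0 : ℝ) < N := by positivity
  have hlog : 0 ≤ Real.log N := Real.log_natCast_nonneg N
  rw [Real.norm_of_nonneg (by positivity), Real.norm_of_nonneg hlog] at hN
  have hM : (N : ℝ) ≤ 3 * ((N / 2 : ℕ) : ℝ) := by
    have : N ≤ 3 * (N / 2) := by omega
    exact_mod_cast this
  have hM0 : (0 : ℝ) < ((N / 2 : ℕ) : ℝ) := by linarith
  have h4 : (K N : ℝ) * 2 ^ K N ≤ Real.sqrt N := by
    have h2 : (2 : ℝ) ^ K N ≤ Real.exp (K N) := by
      rw [← Real.exp_one_pow]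
      exact pow_le_pow_left₀ (by norm_num) (by linarith [Real.add_one_le_exp (1 : ℝ)]) _
    have h3 : (K N : ℝ) ≤ Real.exp (K N) := by linarith [Real.add_one_le_exp (K N : ℝ)]
    calc (K N : ℝ) * 2 ^ K N ≤ Real.exp (K N) * Real.exp (K N) := by gcongr
      _ = Real.exp (2 * K N) := by rw [← Real.exp_add, two_mul]
      _ ≤ Real.exp (Real.log N / 2) := Real.exp_le_exp.mpr (by linarith)
      _ = Real.sqrt N := by rw [← Real.log_sqrt hN0.le, Real.exp_log (Real.sqrt_pos.mpr hN0)]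
  have h5 : (1 - 1 / 2 ^ K N : ℝ) ^ (N / 2) ≤ 2 ^ K N / ((N / 2 : ℕ) : ℝ) := by
    set t : ℝ := ((N / 2 : ℕ) : ℝ) / 2 ^ K N with ht
    have ht0 : 0 < t := by positivity
    calc (1 - 1 / 2 ^ K N : ℝ) ^ (N / 2) ≤ Real.exp (-(1 / 2 ^ K N)) ^ (N / 2) :=
          pow_le_pow_left₀ (hle N) (Real.one_sub_le_exp_neg _) _
      _ = (Real.exp t)⁻¹ := by
          rw [← Real.exp_nat_mul, ← Real.exp_neg, ht]
          congr 1
          ring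
      _ ≤ t⁻¹ := inv_anti₀ ht0 (by linarith [Real.add_one_le_exp t])
      _ = _ := by rw [ht, inv_div]
  calc (K N : ℝ) * (1 - 1 / 2 ^ K N) ^ (N / 2) ≤ K N * (2 ^ K N / ((N / 2 : ℕ) : ℝ)) :=
        mul_le_mul_of_nonneg_left h5 (by positivity)
    _ = K N * 2 ^ K N / ((N / 2 : ℕ) : ℝ) := by ring
    _ ≤ Real.sqrt N / ((N / 2 : ℕ) : ℝ) := by gcongr
    _ ≤ 3 / Real.sqrt N := by
        rw [div_le_div_iff₀ hM0 (Real.sqrt_pos.mpr hN0), Real.mul_self_sqrt hN0.le]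
        exact hM

theorem tendsto_topSet_error {K : ℕ → ℕ}
    (h : (fun N : ℕ => (K N : ℝ)) =o[atTop] (fun N : ℕ => Real.sqrt (N : ℝ))) :
    Tendsto (fun N => (K N : ℝ) * (K N / N)) atTop (𝓝 0) := by
  have h1 := (h.tendsto_div_nhds_zero).pow 2
  rw [zero_pow two_ne_zero] at h1
  refine h1.congr fun N => ?_
  rw [div_pow, Real.sq_sqrt (Nat.cast_nonneg N)]
  ring

/-- For `K ≤ c N` and `n > N / 2`, the proportion `((n - 1) / n) ^ K` is bounded below by a
constant depending on `c` only. -/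
theorem exp_mul_pow_le {N K n : ℕ} {c : ℝ} (hN : 4 ≤ N) (hK : (K : ℝ) ≤ c * N)
    (hn : N < 2 * n) : Real.exp (-(4 * c)) * n ^ K ≤ ((n - 1 : ℕ) : ℝ) ^ K := by
  have hcast : ((n - 1 : ℕ) : ℝ) = n - 1 := by
    rw [Nat.cast_sub (by omega), Nat.cast_one]
  have hn1 : (N : ℝ) ≤ 4 * (n - 1) := by
    rw [← hcast]
    have : N ≤ 4 * (n - 1) := by omega
    exact_mod_cast this
  have hN' : (4 : ℝ) ≤ N := by exact_mod_cast hN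
  have hpos : (0 : ℝ) < n - 1 := by linarith
  have hc : 0 ≤ c := by
    by_contra hc
    have : c * N < 0 := mul_neg_of_neg_of_pos (not_le.mp hc) (by linarith)
    linarith [(Nat.cast_nonneg K : (0 : ℝ) ≤ K)]
  -- Raised to the power `K`, this loses at most `exp (K / (n - 1))`, and `K / (n - 1) ≤ 4 * c`
  -- because `n - 1 ≥ N / 4`.
  have h1 : (n : ℝ) ≤ Real.exp (1 / (n - 1)) * (n - 1) := by
    calc (n : ℝ) = (1 / (n - 1) + 1) * (n - 1) := by field_simp; ring
      _ ≤ _ := mul_le_mul_of_nonneg_right (Real.add_one_le_exp _) hpos.le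
  rw [hcast]
  calc Real.exp (-(4 * c)) * n ^ K
      ≤ Real.exp (-(4 * c)) * (Real.exp (1 / (n - 1)) * (n - 1)) ^ K := by gcongr
    _ = Real.exp (-(4 * c) + K * (1 / (n - 1))) * (n - 1) ^ K := by
        rw [mul_pow, ← Real.exp_nat_mul, Real.exp_add]
        ring
    _ ≤ 1 * (n - 1) ^ K := by
        refine mul_le_mul_of_nonneg_right (Real.exp_le_one_iff.mpr ?_) (by positivity)
        rw [mul_one_div, neg_add_nonpos_iff, div_le_iff₀ hpos]
        nlinarith
    _ = _ := one_mul _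

theorem tendsto_ranking_error {K : ℕ → ℕ} {c r : ℝ} (hr0 : 0 ≤ r) (hr1 : r < 1)
    (h : ∀ᶠ N in atTop, (K N : ℝ) ≤ c * N) :
    Tendsto (fun N => (K N : ℝ) * r ^ (N / 2)) atTop (𝓝 0) := by
  have hdiv : Tendsto (fun N : ℕ => N / 2) atTop atTop :=
    Nat.tendsto_div_const_atTop two_ne_zero
  have h1 : Tendsto (fun M : ℕ => (M : ℝ) * r ^ M) atTop (𝓝 0) :=
    tendsto_self_mul_const_pow_of_lt_one hr0 hr1
  -- The factor `3` absorbs the floor: `N ≤ 3 * (N / 2)` for `N ≥ 2`.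
  have h2 : Tendsto (fun N : ℕ => 3 * c * (((N / 2 : ℕ) : ℝ) * r ^ (N / 2))) atTop (𝓝 0) := by
    simpa using (h1.comp hdiv).const_mul (3 * c)
  refine squeeze_zero' (Eventually.of_forall fun N => by positivity) ?_ h2
  filter_upwards [h, eventually_ge_atTop 2] with N hN hN2
  have hM : (N : ℝ) ≤ 3 * ((N / 2 : ℕ) : ℝ) := by
    have : N ≤ 3 * (N / 2) := by omega
    exact_mod_cast this
  have hc : 0 ≤ c := by
    by_contra hc
    have : c * N < 0 := mul_neg_of_neg_of_pos (not_le.mp hc) (by positivity)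
    linarith [(Nat.cast_nonneg (K N) : (0 : ℝ) ≤ K N)]
  calc (K N : ℝ) * r ^ (N / 2) ≤ (c * (3 * ((N / 2 : ℕ) : ℝ))) * r ^ (N / 2) := by
        gcongr
        exact hN.trans (by gcongr)
    _ = _ := by ring

end ChoiceModel

theorem theorem3 (a b : ℝ) (ha : 0 ≤ a) (hab : a < b) (K : ℕ → ℕ) (hK : ∀ N, 1 ≤ K N) :
    ((fun N : ℕ => (K N : ℝ)) =o[atTop] (fun N : ℕ => Real.log (N : ℝ)) →
      Tendsto (fun N : ℕ => ChoiceModel.drawLaw N (K N) a b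
        (ChoiceModel.goodEvent (K N) (ChoiceModel.comparisonMatrix N))) atTop (𝓝 1)) ∧
    ((fun N : ℕ => (K N : ℝ)) =o[atTop] (fun N : ℕ => Real.sqrt (N : ℝ)) →
      Tendsto (fun N : ℕ => ChoiceModel.drawLaw N (K N) a b
        (ChoiceModel.goodEvent (K N) (ChoiceModel.topSetMatrix N))) atTop (𝓝 1)) ∧
    ((fun N : ℕ => (K N : ℝ)) =O[atTop] (fun N : ℕ => (N : ℝ)) →
      Tendsto (fun N : ℕ => ChoiceModel.drawLaw N (K N) a b
        (ChoiceModel.goodEvent (K N) (ChoiceModel.rankingMatrix N))) atTop (𝓝 1)) := by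
  refine ⟨fun h => ?_, fun h => ?_, fun h => ?_⟩
  · exact ChoiceModel.tendsto_drawLaw_goodEvent hab hK ChoiceModel.comparisonMatrix
      (fun N => (1 - 1 / 2 ^ K N) ^ (N / 2))
      (Eventually.of_forall fun N k =>
        ChoiceModel.comparison_ncard_not_hasSignatureRow_le k)
      (ChoiceModel.tendsto_comparison_error h)
  · refine ChoiceModel.tendsto_drawLaw_goodEvent hab hK ChoiceModel.topSetMatrix
      (fun N => (K N : ℝ) / N) ?_ (ChoiceModel.tendsto_topSet_error h)
    filter_upwards [eventually_gt_atTop 0] with N hN k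
    exact ChoiceModel.topSet_ncard_not_hasSignatureRow_le hN k
  · obtain ⟨c, hc, hbound⟩ := h.exists_pos
    have hKc : ∀ᶠ N : ℕ in atTop, (K N : ℝ) ≤ c * N := by
      filter_upwards [hbound.bound] with N hN
      simpa using hN
    -- The success probability per product, `δ = exp (-(4 * c))`, does not depend on `N`, so failure
    -- decays geometrically and beats the linear growth of `K`.
    have hexp : Real.exp (-(4 * c)) ≤ 1 := Real.exp_le_one_iff.mpr (by linarith)
    refine ChoiceModel.tendsto_drawLaw_goodEvent hab hK ChoiceModel.rankingMatrix
      (fun N => (1 - Real.exp (-(4 * c))) ^ (N / 2)) ?_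
      (ChoiceModel.tendsto_ranking_error (sub_nonneg.mpr hexp)
        (by linarith [Real.exp_pos (-(4 * c))]) hKc)
    filter_upwards [hKc, eventually_ge_atTop 4] with N hN h4 k
    exact ChoiceModel.ranking_ncard_not_hasSignatureRow_le k hexp
      fun n hn => ChoiceModel.exp_mul_pow_le h4 hN hn
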